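/- **Definitions.** Let $C$ be a finite non-empty set of candidates. A profile $\mathcal R=(\succ_1,\dots,\succ_n)$ on $C$ consists of $n\ge 1$ linear orders on $C$ (the voters). A non-empty set $X\subseteq C$ is a clone set of $\mathcal R$ if for all $c,c'\in X$, $a\in C\setminus X$ and all $i$: $c\succ_i a\iff c'\succ_i a$. Let $\mathcal C(\mathcal R)$ be the family of all clone sets of $\mathcal R$. A family $\mathcal C\subseteq 2^C$ is a *clone structure* if $\mathcal C=\mathcal C(\mathcal R)$ for some profile $\mathcal R$ on $C$, and it is *$k$-implementable* if such an $\mathcal R$ with exactly $k$ voters exists (voters may have equal orders). A family on $C$ is a *string of sausages* if, for some enumeration $c_1,\dots,c_m$ of $C$ without repetition, it consists of the sets $\{c_i,c_{i+1},\dots,c_j\}$, $i\le j$; it is a *fat sausage* if it consists of $C$ and the singletons of $C$. A set $E\in\mathcal C$ *supports* the subfamily $\mathcal C_E=\{X\in\mathcal C: X\subseteq E\}$ if every $X\in\mathcal C\setminus\mathcal C_E$ satisfies $E\subseteq X$ or $X\cap E=\emptyset$. The family $\mathcal C$ is *irreducible* if no $E$ with $1<|E|<|C|$ supports a subfamily.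 The *decomposition* of $\mathcal C$ is the collection of all $E$ with $|E|\ge 2$ that support a subfamily $\mathcal C_E$ which is irreducible (as a family on $E$); for a clone structure $\mathcal C$ its members are pairwise disjoint. A *PQ-tree $T(\mathcal C)$* of $\mathcal C$ is an ordered tree whose leaves are labelled by candidates and whose internal nodes have type P or Q, defined as follows. If $|C|=1$, it is a single leaf. If $|C|\ge2$ and $\mathcal C$ is an irreducible fat sausage, it is a P-node whose children are leaves labelled by the elements of $C$, in any order. If $|C|\ge 3$ and $\mathcal C$ is an irreducible string of sausages along $c_1,\dots,c_m$, it is a Q-node whose children are leaves labelled $c_1,\dots,c_m$ in this order. If $\mathcal C$ is reducible with decomposition $\{C_1,\dots,C_k\}$, let $\mathcal C'$ be the family on $(C\setminus\bigcup_i C_i)\cup\{c^1,\dots,c^k\}$ (with new candidates $c^i$) obtained from $\mathcal C$ by removing each $X\in\mathcal C$ that is strictly contained in some $C_i$ and, in the remaining sets, replacing each contained $C_i$ by $c^i$; then $T(\mathcal C)$ is a tree $T(\mathcal C')$ in which, for each $i$, the leaf $c^i$ is replaced by a tree $T(\mathcal C_{C_i})$. **Theorem.** Let $\mathcal C$ be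 a clone structure on a finite non-empty set $C$. Then: 1. $\mathcal C$ is $3$-implementable. 2. $\mathcal C$ has a PQ-tree $T(\mathcal C)$, and if some PQ-tree $T(\mathcal C)$ of $\mathcal C$ has no P-node with exactly three children, then $\mathcal C$ is $2$-implementable. 3. If $\mathcal C$ is a string of sausages, then $\mathcal C$ is $1$-implementable. -/

import Mathlib

universe u

namespace CloneStructures

/-! Preference profiles and their clone sets -/

/-- A profile of `n` voters on the candidate set `V`: voter `i` has the (strict) linear preference
order `R i`, where `c ≻ᵢ a` is `(R i).lt a c` (greater means more preferred). -/
abbrev Profile (V : Type u) (n : ℕ) : Type u := Fin n → LinearOrder V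

/-- `c` is preferred to `a` by voter `i`. -/
def Prefers {V : Type u} {n : ℕ} (R : Profile V n) (i : Fin n) (c a : V) : Prop :=
  (R i).lt a c

/-- A clone set is a non-empty set whose members are ranked alike, by every voter, against every
candidate outside the set. -/
def IsCloneSet {V : Type u} {n : ℕ} (R : Profile V n) (X : Set V) : Prop :=
  X.Nonempty ∧ ∀ c ∈ X, ∀ c' ∈ X, ∀ a, a ∉ X → ∀ i, Prefers R i c a ↔ Prefers R i c' a

/-- The family of all clone sets of a profile. -/
def clones {V : Type u} {n : ℕ} (R : Profile V n) : Set (Set V) := {X | IsCloneSet R X}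

/-- `F` is the family of all clone sets of some profile with exactly `k` voters. -/
def Implementable {V : Type u} (k : ℕ) (F : Set (Set V)) : Prop :=
  ∃ R : Profile V k, F = clones R

/-- A clone structure is the family of all clone sets of some profile (with at least one voter). -/
def IsCloneStructure {V : Type u} (F : Set (Set V)) : Prop :=
  ∃ n : ℕ, 1 ≤ n ∧ Implementable n F

/-! Strings of sausages and fat sausages -/

/-- `F` is the string of sausages of the order `c 0, c 1, …, c (m-1)` of the candidates: its
members are the sets `{c i, c (i+1), …, c j}` with `i ≤ j`. -/
def IsStringAlong {V : Type u} {m : ℕ} (c : Fin m ≃ V) (F : Set (Set V)) : Prop :=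
  F = {X | ∃ i j : Fin m, i ≤ j ∧ X = c '' Set.Icc i j}

/-- `F` is a string of sausages. -/
def IsString {V : Type u} (F : Set (Set V)) : Prop :=
  ∃ (m : ℕ) (c : Fin m ≃ V), IsStringAlong c F

/-- `F` is a fat sausage: it consists of the singletons and the whole candidate set. -/
def IsFat {V : Type u} (F : Set (Set V)) : Prop :=
  F = {X | X = Set.univ ∨ ∃ a, X = {a}}

/-! Subfamilies, irreducibility, decomposition -/

/-- `E` is the support of a subfamily of `F`, namely of `{X ∈ F | X ⊆ E}`. -/
def IsSupport {V : Type u} (F : Set (Set V)) (E : Set V) : Prop :=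
  E ∈ F ∧ ∀ X ∈ F, ¬ X ⊆ E → E ⊆ X ∨ X ∩ E = ∅

/-- The subfamily `{X ∈ F | X ⊆ E}`, as a family of subsets of `E`. -/
def restrict {V : Type u} (F : Set (Set V)) (E : Set V) : Set (Set E) :=
  {Y | Subtype.val '' Y ∈ F}

/-- `F` has no proper subfamily, that is, none whose support is a proper subset `E` in the sense
`1 < |E| < |V|`. -/
def Irreducible {V : Type u} (F : Set (Set V)) : Prop :=
  ¬ ∃ E : Set V, E.Nontrivial ∧ E ≠ Set.univ ∧ IsSupport F E

/-- The decomposition of `F`: all sets with at least two elements that support an irreducible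
subfamily of `F`. (Two such sets are equal or disjoint.) -/
def decomposition {V : Type u} (F : Set (Set V)) : Set (Set V) :=
  {E | E.Nontrivial ∧ IsSupport F E ∧ Irreducible (restrict F E)}

/-- The candidates that are left after collapsing each set `E` of the decomposition to one new
candidate `Sum.inr E`. -/
abbrev Collapsed {V : Type u} (F : Set (Set V)) : Type u :=
  {a : V // ∀ E ∈ decomposition F, a ∉ E} ⊕ {E : Set V // E ∈ decomposition F}

/-- Replace in `X` each set `E ⊆ X` of the decomposition by the new candidate for `E`. -/
def collapseSet {V : Type u} (F : Set (Set V)) (X : Set V) : Set (Collapsed F) :=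
  {s | Sum.elim (fun a => a.1 ∈ X) (fun E => E.1 ⊆ X) s}

/-- The family that results from `F` by collapsing all the sets of the decomposition: members of
`F` properly inside such a set are removed, and the others are rewritten. -/
def collapse {V : Type u} (F : Set (Set V)) : Set (Set (Collapsed F)) :=
  {Y | ∃ X ∈ F, (∀ E ∈ decomposition F, ¬ X ⊂ E) ∧ Y = collapseSet F X}

/-! PQ-trees -/

/-- Ordered trees with leaves labelled in `V` and internal nodes of type P or Q. A P-node with
children `x₁, …, x_k` is the one labelled `x₁ ⊙ ⋯ ⊙ x_k`. -/
inductive PQTree (V : Type u) : Type u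
  | leaf (a : V) : PQTree V
  | pnode (k : ℕ) (children : Fin k → PQTree V) : PQTree V
  | qnode (k : ℕ) (children : Fin k → PQTree V) : PQTree V

/-- Replace each leaf `a` by the tree `f a`. -/
def PQTree.bind {V W : Type u} (f : V → PQTree W) : PQTree V → PQTree W
  | .leaf a => f a
  | .pnode k ch => .pnode k fun i => (ch i).bind f
  | .qnode k ch => .qnode k fun i => (ch i).bind f

/-- The tree has a P-node with exactly `d` children. -/
def PQTree.HasPNode {V : Type u} (d : ℕ) : PQTree V → Prop
  | .leaf _ => False
  | .pnode k ch => k = d ∨ ∃ i, (ch i).HasPNode d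
  | .qnode _ ch => ∃ i, (ch i).HasPNode d

/-- `IsPQTree F T`: the tree `T` is associated with the family `F`. (It is determined by `F` up to
permuting the children of P-nodes and reversing those of Q-nodes.) If `F` is irreducible, `T` is
a P-node (fat sausage, at least two candidates) or a Q-node (string of sausages, at least three
candidates) whose children are leaves, or a single leaf if there is only one candidate.
If `F` is reducible, take a tree for the collapsed family and replace each
leaf that stands for a set `E` of the decomposition by a tree for the subfamily supported
by `E`. -/
inductive IsPQTree : {V : Type u} → Set (Set V) → PQTree V → Prop
  | single {V : Type u} {F : Set (Set V)} (a : V) (ha : ∀ b, b = a) (hF : IsFat F) :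
      IsPQTree F (.leaf a)
  | fat {V : Type u} {F : Set (Set V)} (hirr : Irreducible F) (hF : IsFat F)
      {m : ℕ} (hm : 2 ≤ m) (c : Fin m ≃ V) :
      IsPQTree F (.pnode m fun i => .leaf (c i))
  | string {V : Type u} {F : Set (Set V)} (hirr : Irreducible F)
      {m : ℕ} (hm : 3 ≤ m) (c : Fin m ≃ V) (hF : IsStringAlong c F) :
      IsPQTree F (.qnode m fun i => .leaf (c i))
  | reducible {V : Type u} {F : Set (Set V)} (hred : ¬ Irreducible F)
      (S : (E : {E : Set V // E ∈ decomposition F}) → PQTree E.1)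
      (hS : ∀ E, IsPQTree (restrict F E.1) (S E))
      (T : PQTree (Collapsed F)) (hT : IsPQTree (collapse F) T) :
      IsPQTree F (T.bind (Sum.elim (fun a => .leaf a.1)
        (fun E => (S E).bind fun x => .leaf x.1)))

end CloneStructures

namespace CloneStructures

/-! ### Clone sets as common intervals -/

section Basic

variable {V : Type u} {n : ℕ} {R : Profile V n} {X Y : Set V}

/-! Clone sets are the common intervals of the voters' orders. They are closed under unions and
differences of crossing pairs, and this forces an irreducible clone structure to be a fat sausage or
a string of sausages (`isStringAlong_of_irreducible`). Restricting to the sets of the decomposition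
and collapsing them gives clone structures on fewer candidates, so PQ-trees exist by induction on
the number of candidates (`exists_isPQTree`).

A profile is then built along the tree (`IsPQTree.implementable`). Strings need one order, shared by
all voters; fat sausages on at least four candidates need two orders, those on three candidates get
three. To glue, each collapsed candidate is expanded lexicographically into an order on its fiber
(`implementable_of_fibers`). The only danger is a new clone set that crosses a fiber: it would cut
the fiber in the same voter pattern in which a neighboring block lies above or below it. Cut
patterns of one profile agree up to complement, and so do neighbor patterns at one candidate. With
at least two voters, reversing a single voter inside the fiber therefore destroys any coincidence
and leaves the fiber's clone sets unchanged (`exists_orientation`).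

Gluing needs two voters, so the one-voter claim is read off directly from the order of the string.
-/

theorem not_prefers_self (i : Fin n) (a : V) : ¬ Prefers R i a a :=
  @lt_irrefl V (R i).toPreorder a

theorem Prefers.trans {i : Fin n} {a b c : V} (h₁ : Prefers R i a b) (h₂ : Prefers R i b c) :
    Prefers R i a c :=
  @lt_trans V (R i).toPreorder c b a h₂ h₁

theorem Prefers.asymm {i : Fin n} {a b : V} (h : Prefers R i a b) : ¬ Prefers R i b a :=
  fun h' => not_prefers_self i a (h.trans h')

theorem prefers_or_prefers (i : Fin n) {a b : V} (h : a ≠ b) :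
    Prefers R i a b ∨ Prefers R i b a :=
  (@lt_or_gt_of_ne V (R i) a b h).symm

theorem not_prefers_iff (i : Fin n) {a b : V} (h : a ≠ b) :
    ¬ Prefers R i a b ↔ Prefers R i b a :=
  ⟨fun h' => (prefers_or_prefers i h).resolve_left h', Prefers.asymm⟩

/-- An outside candidate ranked between two members is exactly what makes these members rank
differently against it. In this convexity form, closure under intersections is immediate. -/
theorem mem_clones_iff : X ∈ clones R ↔ X.Nonempty ∧
    ∀ i, ∀ a ∈ X, ∀ b ∈ X, ∀ x, Prefers R i b x → Prefers R i x a → x ∈ X := by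
  refine and_congr_right fun _ => ⟨fun h i a ha b hb x hbx hxa => ?_, fun h => ?_⟩
  · by_contra hx
    exact hxa.asymm ((h b hb a ha x hx i).1 hbx)
  · have key : ∀ c ∈ X, ∀ c' ∈ X, ∀ a, a ∉ X → ∀ i, Prefers R i c a → Prefers R i c' a := by
      intro c hc c' hc' a ha i hca
      by_contra hn
      have hne : c' ≠ a := by rintro rfl; exact ha hc'
      exact ha (h i c' hc' c hc a hca ((not_prefers_iff i hne).1 hn))
    exact fun c hc c' hc' a ha i => ⟨key c hc c' hc' a ha i, key c' hc' c hc a ha i⟩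

theorem nonempty_of_mem_clones (h : X ∈ clones R) : X.Nonempty := h.1

theorem between_mem (hX : X ∈ clones R) {i : Fin n} {a b x : V} (ha : a ∈ X) (hb : b ∈ X)
    (h₁ : Prefers R i b x) (h₂ : Prefers R i x a) : x ∈ X :=
  (mem_clones_iff.1 hX).2 i a ha b hb x h₁ h₂

/-- Members of a clone set are also ranked alike from the outside. -/
theorem prefers_congr_right (hX : X ∈ clones R) {c c' a : V} (hc : c ∈ X) (hc' : c' ∈ X)
    (ha : a ∉ X) (i : Fin n) : Prefers R i a c ↔ Prefers R i a c' := by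
  have hne : ∀ d ∈ X, d ≠ a := by rintro d hd rfl; exact ha hd
  rw [← not_prefers_iff i (hne c hc), ← not_prefers_iff i (hne c' hc')]
  exact not_congr (hX.2 c hc c' hc' a ha i)

theorem singleton_mem_clones (R : Profile V n) (a : V) : {a} ∈ clones R := by
  refine mem_clones_iff.2 ⟨Set.singleton_nonempty a, ?_⟩
  rintro i _ rfl _ rfl x h₁ h₂
  exact (h₁.asymm h₂).elim

theorem univ_mem_clones [Nonempty V] (R : Profile V n) : Set.univ ∈ clones R :=
  mem_clones_iff.2 ⟨Set.univ_nonempty, fun _ _ _ _ _ _ _ _ => Set.mem_univ _⟩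

theorem sInter_mem_clones {G : Set (Set V)} (hG : ∀ X ∈ G, X ∈ clones R)
    (hne : (⋂₀ G).Nonempty) : ⋂₀ G ∈ clones R :=
  mem_clones_iff.2 ⟨hne, fun _ _ ha _ hb _ h₁ h₂ X hX =>
    between_mem (hG X hX) (ha X hX) (hb X hX) h₁ h₂⟩

theorem inter_mem_clones (hX : X ∈ clones R) (hY : Y ∈ clones R) (hne : (X ∩ Y).Nonempty) :
    X ∩ Y ∈ clones R :=
  mem_clones_iff.2 ⟨hne, fun _ _ ha _ hb _ h₁ h₂ =>
    ⟨between_mem hX ha.1 hb.1 h₁ h₂, between_mem hY ha.2 hb.2 h₁ h₂⟩⟩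

theorem union_mem_clones (hX : X ∈ clones R) (hY : Y ∈ clones R) (hne : (X ∩ Y).Nonempty) :
    X ∪ Y ∈ clones R := by
  obtain ⟨z, hzX, hzY⟩ := hne
  refine ⟨⟨z, Or.inl hzX⟩, ?_⟩
  have key : ∀ c ∈ X ∪ Y, ∀ a, a ∉ X ∪ Y → ∀ i, Prefers R i c a ↔ Prefers R i z a := by
    rintro c (hc | hc) a ha i
    · exact hX.2 c hc z hzX a (fun h => ha (Or.inl h)) i
    · exact hY.2 c hc z hzY a (fun h => ha (Or.inr h)) i
  exact fun c hc c' hc' a ha i => (key c hc a ha i).trans (key c' hc' a ha i).symm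

/-- Each voter puts a point `z` of `Y \ X` on one side of all of `X`. If a point of `X ∩ Y` lay
between two points of `X \ Y`, the one of these on the side of `z` would lie between two members of
`Y`. -/
theorem diff_mem_clones (hX : X ∈ clones R) (hY : Y ∈ clones R) (hXY : (X \ Y).Nonempty)
    (hYX : (Y \ X).Nonempty) : X \ Y ∈ clones R := by
  obtain ⟨z, hzY, hzX⟩ := hYX
  refine mem_clones_iff.2 ⟨hXY, fun i a ha b hb x h₁ h₂ =>
    ⟨between_mem hX ha.1 hb.1 h₁ h₂, fun hx => ?_⟩⟩
  have hza : z ≠ a := by rintro rfl; exact hzX ha.1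
  rcases prefers_or_prefers (R := R) i hza with h | h
  · exact hb.2 (between_mem hY hx hzY ((prefers_congr_right hX ha.1 hb.1 hzX i).1 h) h₁)
  · exact ha.2 (between_mem hY hzY hx h₂ h)

theorem isFat_clones_iff [Nonempty V] :
    IsFat (clones R) ↔ ∀ X ∈ clones R, X.Nontrivial → X = Set.univ := by
  constructor
  · intro h X hX hnt
    rw [h] at hX
    rcases hX with hX | ⟨a, rfl⟩
    · exact hX
    · exact (Set.not_nontrivial_singleton hnt).elim
  · intro h
    ext X
    constructor
    · intro hX
      rcases (nonempty_of_mem_clones hX).exists_eq_singleton_or_nontrivial with hs | hs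
      · exact Or.inr hs
      · exact Or.inl (h X hX hs)
    · rintro (rfl | ⟨a, rfl⟩)
      · exact univ_mem_clones R
      · exact singleton_mem_clones R a

end Basic

/-! ### Assembling a profile from the fibers of a map -/

section Assemble

variable {V W : Type u} {k : ℕ}

/-- The reverse of a linear order. -/
abbrev reverseOrder (q : LinearOrder V) : LinearOrder V :=
  LinearOrder.lift' OrderDual.toDual OrderDual.toDual.injective

/-- The profile that results from `S` by reversing the order of voter `j`. -/
abbrev reverseVoter (S : Profile V k) (j : Fin k) : Profile V k :=
  Function.update S j (reverseOrder (S j))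

theorem prefers_reverseVoter_same (S : Profile V k) (j : Fin k) (a b : V) :
    Prefers (reverseVoter S j) j a b ↔ Prefers S j b a :=
  iff_of_eq (congrArg (fun q : LinearOrder V => q.lt b a) (Function.update_self j _ S))

theorem prefers_reverseVoter_of_ne (S : Profile V k) {i j : Fin k} (h : i ≠ j) (a b : V) :
    Prefers (reverseVoter S j) i a b ↔ Prefers S i a b :=
  iff_of_eq (congrArg (fun q : LinearOrder V => q.lt b a) (Function.update_of_ne h _ S))

theorem clones_reverseVoter (S : Profile V k) (j : Fin k) :
    clones (reverseVoter S j) = clones S := by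
  ext X
  rw [mem_clones_iff, mem_clones_iff]
  refine and_congr_right fun _ => forall_congr' fun i => ?_
  by_cases h : i = j
  · subst h
    simp only [prefers_reverseVoter_same]
    exact ⟨fun H a ha b hb x h₁ h₂ => H b hb a ha x h₂ h₁,
      fun H a ha b hb x h₁ h₂ => H b hb a ha x h₂ h₁⟩
  · simp only [prefers_reverseVoter_of_ne S h]

/-- The candidates split into two sets, the first of which is preferred to the second by exactly
the voters in `σ`, and vice versa by the others. -/
def IsCutPattern (S : Profile V k) (σ : Set (Fin k)) : Prop :=
  ∃ A : Set V, A.Nonempty ∧ Aᶜ.Nonempty ∧ ∀ a ∈ A, ∀ b ∈ Aᶜ, ∀ i, Prefers S i a b ↔ i ∈ σ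

/-- Some set is a neighbor of `w` in all orders, above `w` for exactly the voters in `σ`. -/
def IsNeighborPattern (Q : Profile W k) (w : W) (σ : Set (Fin k)) : Prop :=
  ∃ Z : Set W, Z.Nonempty ∧ w ∉ Z ∧ insert w Z ∈ clones Q ∧
    ∀ u ∈ Z, ∀ i, Prefers Q i u w ↔ i ∈ σ

/-- Two bipartitions always have a pair of candidates that both of them separate. Comparing that
pair reads off both patterns, with equal or opposite orientation. -/
theorem IsCutPattern.eq_or_eq_compl {S : Profile V k} {σ τ : Set (Fin k)}
    (hσ : IsCutPattern S σ) (hτ : IsCutPattern S τ) : σ = τ ∨ σ = τᶜ := by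
  obtain ⟨A, hA, hA', h⟩ := hσ
  obtain ⟨B, hB, hB', h'⟩ := hτ
  by_cases h₁ : (A ∩ B).Nonempty ∧ (Aᶜ ∩ Bᶜ).Nonempty
  · obtain ⟨⟨a, haA, haB⟩, ⟨b, hbA, hbB⟩⟩ := h₁
    exact Or.inl (Set.ext fun i => (h a haA b hbA i).symm.trans (h' a haB b hbB i))
  · have h₂ : (A ∩ Bᶜ).Nonempty ∧ (Aᶜ ∩ B).Nonempty := by
      rcases not_and_or.1 h₁ with h₁ | h₁ <;> rw [Set.not_nonempty_iff_eq_empty] at h₁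
      · obtain ⟨a, ha⟩ := hA
        obtain ⟨b, hb⟩ := hB
        exact ⟨⟨a, ha, fun hb' => (h₁.subset ⟨ha, hb'⟩).elim⟩,
          ⟨b, fun ha' => (h₁.subset ⟨ha', hb⟩).elim, hb⟩⟩
      · obtain ⟨a, ha⟩ := hA'
        obtain ⟨b, hb⟩ := hB'
        exact ⟨⟨b, by_contra fun ha' => (h₁.subset ⟨ha', hb⟩).elim, hb⟩,
          ⟨a, ha, by_contra fun hb' => (h₁.subset ⟨ha, hb'⟩).elim⟩⟩
    obtain ⟨⟨a, haA, haB⟩, ⟨b, hbA, hbB⟩⟩ := h₂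
    refine Or.inr (Set.ext fun i => ?_)
    have hne : b ≠ a := by rintro rfl; exact hbA haA
    rw [← h a haA b hbA i, Set.mem_compl_iff, ← h' b hbB a haB i, not_prefers_iff i hne]

/-- If the two neighbors meet, a common point decides both patterns. If they are disjoint, each
block together with `w` is a clone set as seen from the other block, so `w` lies between them for
every voter. -/
theorem IsNeighborPattern.eq_or_eq_compl {Q : Profile W k} {w : W} {σ τ : Set (Fin k)}
    (hσ : IsNeighborPattern Q w σ) (hτ : IsNeighborPattern Q w τ) : σ = τ ∨ σ = τᶜ := by
  obtain ⟨Z, hZ, hwZ, hc, h⟩ := hσ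
  obtain ⟨Z', hZ', hwZ', hc', h'⟩ := hτ
  by_cases hd : (Z ∩ Z').Nonempty
  · obtain ⟨u, hu, hu'⟩ := hd
    exact Or.inl (Set.ext fun i => (h u hu i).symm.trans (h' u hu' i))
  · rw [Set.not_nonempty_iff_eq_empty] at hd
    obtain ⟨u, hu⟩ := hZ
    obtain ⟨v, hv⟩ := hZ'
    have huw : u ≠ w := by rintro rfl; exact hwZ hu
    have hvw : v ≠ w := by rintro rfl; exact hwZ' hv
    have hu' : u ∉ insert w Z' := by
      rintro (h₁ | h₁)
      exacts [huw h₁, (hd.subset ⟨hu, h₁⟩).elim]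
    have hv' : v ∉ insert w Z := by
      rintro (h₁ | h₁)
      exacts [hvw h₁, (hd.subset ⟨h₁, hv⟩).elim]
    refine Or.inr (Set.ext fun i => ?_)
    rw [← h u hu i, Set.mem_compl_iff, ← h' v hv i]
    have e₁ := hc.2 w (Or.inl rfl) u (Or.inr hu) v hv' i
    have e₂ := hc'.2 w (Or.inl rfl) v (Or.inr hv) u hu' i
    have e₃ := prefers_congr_right hc (Or.inl rfl) (Or.inr hu) hv' i
    have e₄ := prefers_congr_right hc' (Or.inl rfl) (Or.inr hv) hu' i
    rw [not_prefers_iff i hvw]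
    constructor
    · intro h₁
      by_contra h₂
      rw [not_prefers_iff i hvw.symm] at h₂
      exact (e₃.1 h₂).asymm (e₄.1 h₁)
    · intro h₁
      by_contra h₂
      rw [not_prefers_iff i huw] at h₂
      exact (e₁.1 h₁).asymm (e₂.1 h₂)

/-- A profile with at least two voters can be oriented, without changing its clone sets, in such
a way that it avoids the neighbor pattern of `w`. -/
theorem exists_orientation (hk : 2 ≤ k) (Q : Profile W k) (w : W) (S : Profile V k) :
    ∃ S' : Profile V k, clones S' = clones S ∧
      ∀ σ, IsNeighborPattern Q w σ → ¬ IsCutPattern S' σ := by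
  by_contra! hbad
  let j : Fin k := ⟨0, by omega⟩
  let l : Fin k := ⟨1, by omega⟩
  have hlj : l ≠ j := by simp [l, j]
  obtain ⟨σ, hσ, hSσ⟩ := hbad S rfl
  obtain ⟨τ, hτ, hSτ⟩ := hbad (reverseVoter S j) (clones_reverseVoter S j)
  -- Undoing the reversal toggles the membership of `j` in `τ`.
  have hflip : IsCutPattern S {i | i = j ∧ i ∉ τ ∨ i ≠ j ∧ i ∈ τ} := by
    obtain ⟨A, hA, hA', h⟩ := hSτ
    refine ⟨A, hA, hA', fun a ha b hb i => ?_⟩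
    have hne : b ≠ a := by rintro rfl; exact hb ha
    have h := h a ha b hb i
    by_cases hi : i = j
    · subst hi
      rw [prefers_reverseVoter_same, ← not_prefers_iff j hne.symm] at h
      simp only [Set.mem_ofPred_eq]
      tauto
    · rw [prefers_reverseVoter_of_ne S hi] at h
      simp only [Set.mem_ofPred_eq]
      tauto
  -- Up to complement, `σ` is both `τ` and `τ` toggled at `j`. Toggling changes membership at `j`
  -- but not at `l`, so this is impossible.
  have h₁ := hσ.eq_or_eq_compl hτ
  have h₂ := hSσ.eq_or_eq_compl hflip
  simp only [Set.ext_iff, Set.mem_compl_iff, Set.mem_ofPred_eq] at h₁ h₂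
  rcases h₁ with h₁ | h₁ <;> rcases h₂ with h₂ | h₂ <;>
    · have a₁ := h₁ j
      have a₂ := h₁ l
      have b₁ := h₂ j
      have b₂ := h₂ l
      simp only [hlj, true_and, false_and, not_true_eq_false, not_false_eq_true, ne_eq, or_false,
        false_or] at b₁ b₂
      tauto

/-- The lexicographic order on `V` given by an order on `W` and orders on the fibers of `π`. -/
noncomputable abbrev fiberLex (π : V → W) (q : LinearOrder W)
    (s : ∀ w, LinearOrder (π ⁻¹' {w} : Set V)) : LinearOrder V :=
  LinearOrder.lift' (fun v => (toLex ⟨π v, ⟨v, rfl⟩⟩ : Σₗ w, (π ⁻¹' {w} : Set V))) (by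
    intro a b h
    have h : (⟨π a, ⟨a, rfl⟩⟩ : Σ w, (π ⁻¹' {w} : Set V)) = ⟨π b, ⟨b, rfl⟩⟩ := toLex.injective h
    exact congrArg (fun x : Σ w, (π ⁻¹' {w} : Set V) => (x.2 : V)) h)

theorem fiberLex_lt_of_ne (π : V → W) (q : LinearOrder W)
    (s : ∀ w, LinearOrder (π ⁻¹' {w} : Set V)) {a b : V} (h : π a ≠ π b) :
    (fiberLex π q s).lt a b ↔ q.lt (π a) (π b) := by
  change (toLex ⟨π a, ⟨a, rfl⟩⟩ : Σₗ w, (π ⁻¹' {w} : Set V)) < toLex ⟨π b, ⟨b, rfl⟩⟩ ↔ _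
  rw [Sigma.Lex.lt_def]
  constructor
  · intro h'
    rcases h' with h' | ⟨h', -⟩
    exacts [h', (h h').elim]
  · exact Or.inl

theorem fiberLex_lt_iff (π : V → W) (q : LinearOrder W)
    (s : ∀ w, LinearOrder (π ⁻¹' {w} : Set V)) (w : W) (a b : (π ⁻¹' {w} : Set V)) :
    (fiberLex π q s).lt a.1 b.1 ↔ (s w).lt a b := by
  obtain ⟨a, rfl⟩ := a
  obtain ⟨b, hb⟩ := b
  have hb : π b = π a := hb
  change (toLex ⟨π a, ⟨a, rfl⟩⟩ : Σₗ w, (π ⁻¹' {w} : Set V)) < toLex ⟨π b, ⟨b, rfl⟩⟩ ↔ _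
  have e : (toLex ⟨π b, ⟨b, rfl⟩⟩ : Σₗ w, (π ⁻¹' {w} : Set V)) = toLex ⟨π a, ⟨b, hb⟩⟩ := by
    congr 1
    exact Sigma.subtype_ext hb rfl
  rw [e, Sigma.Lex.lt_def]
  constructor
  · rintro (h' | ⟨_, h'⟩)
    exacts [(lt_irrefl _ h').elim, h']
  · exact fun h' => Or.inr ⟨rfl, h'⟩

/-- A clone structure can be assembled from the quotient by a map whose fibers are supports of
subfamilies, and from these subfamilies. -/
theorem implementable_of_fibers (hk : 2 ≤ k) {π : V → W} (hπ : π.Surjective) {F : Set (Set V)}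
    (hsupp : ∀ w, IsSupport F (π ⁻¹' {w})) (hquot : Implementable k {Y | π ⁻¹' Y ∈ F})
    (hfib : ∀ w, Implementable k (restrict F (π ⁻¹' {w}))) : Implementable k F := by
  obtain ⟨Q, hQ⟩ := hquot
  have hS : ∀ w, ∃ S : Profile (π ⁻¹' {w} : Set V) k, restrict F (π ⁻¹' {w}) = clones S ∧
      ∀ σ, IsNeighborPattern Q w σ → ¬ IsCutPattern S σ := by
    intro w
    obtain ⟨S, hS⟩ := hfib w
    obtain ⟨S', hS', h⟩ := exists_orientation hk Q w S
    exact ⟨S', hS.trans hS'.symm, h⟩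
  choose S hS hSQ using hS
  let R : Profile V k := fun i => fiberLex π (Q i) fun w => S w i
  have hRQ : ∀ i {a b}, π a ≠ π b → (Prefers R i a b ↔ Prefers Q i (π a) (π b)) :=
    fun i a b h => fiberLex_lt_of_ne π (Q i) _ h.symm
  have hRS : ∀ i w (a b : (π ⁻¹' {w} : Set V)), Prefers R i a.1 b.1 ↔ Prefers (S w) i a b :=
    fun i w a b => fiberLex_lt_iff π (Q i) (fun w => S w i) w b a
  have hinside : ∀ w (X : Set V), X ⊆ π ⁻¹' {w} → (X ∈ clones R ↔ X ∈ F) := by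
    intro w X hX
    obtain ⟨X, rfl⟩ : ∃ X' : Set (π ⁻¹' {w} : Set V), X = Subtype.val '' X' :=
      ⟨Subtype.val ⁻¹' X, by rw [Subtype.image_preimage_coe, Set.inter_eq_right.2 hX]⟩
    change _ ↔ X ∈ restrict F (π ⁻¹' {w})
    rw [hS w, mem_clones_iff, mem_clones_iff, Set.image_nonempty]
    refine and_congr_right fun _ => forall_congr' fun i => ⟨fun h a ha b hb x h₁ h₂ => ?_, ?_⟩
    · obtain ⟨y, hy, hyx⟩ := h a ⟨a, ha, rfl⟩ b ⟨b, hb, rfl⟩ x ((hRS i w _ _).2 h₁)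
        ((hRS i w _ _).2 h₂)
      rwa [← Subtype.ext hyx]
    · rintro h _ ⟨a, ha, rfl⟩ _ ⟨b, hb, rfl⟩ x h₁ h₂
      have hx : π x = w := by
        by_contra hx
        have ha' : π a.1 = w := a.2
        have hb' : π b.1 = w := b.2
        have h₁ := (hRQ i (by rw [hb']; exact Ne.symm hx)).1 h₁
        have h₂ := (hRQ i (by rw [ha']; exact hx)).1 h₂
        rw [hb'] at h₁
        rw [ha'] at h₂
        exact h₁.asymm h₂
      exact ⟨⟨x, hx⟩, h a ha b hb ⟨x, hx⟩ ((hRS i w b ⟨x, hx⟩).1 h₁)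
        ((hRS i w ⟨x, hx⟩ a).1 h₂), rfl⟩
  have hunion : ∀ Y : Set W, π ⁻¹' Y ∈ clones R ↔ Y ∈ clones Q := by
    intro Y
    constructor
    · rintro ⟨hne, h⟩
      refine ⟨?_, fun c hc c' hc' a ha i => ?_⟩
      · obtain ⟨v, hv⟩ := hne
        exact ⟨π v, hv⟩
      · obtain ⟨c, rfl⟩ := hπ c
        obtain ⟨c', rfl⟩ := hπ c'
        obtain ⟨a, rfl⟩ := hπ a
        rw [← hRQ i (fun h => ha (h ▸ hc)), ← hRQ i (fun h => ha (h ▸ hc'))]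
        exact h c hc c' hc' a ha i
    · rintro ⟨⟨y, hy⟩, h⟩
      refine ⟨?_, fun c hc c' hc' a ha i => ?_⟩
      · obtain ⟨v, rfl⟩ := hπ y
        exact ⟨v, hy⟩
      · have hca : π c ≠ π a := fun h => ha (Set.mem_preimage.2 (h ▸ hc))
        have hca' : π c' ≠ π a := fun h => ha (Set.mem_preimage.2 (h ▸ hc'))
        rw [hRQ i hca, hRQ i hca']
        exact h _ hc _ hc' _ ha i
  refine ⟨R, Set.ext fun X => ?_⟩
  by_cases hin : ∃ w, X ⊆ π ⁻¹' {w}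
  · obtain ⟨w, hw⟩ := hin
    exact (hinside w X hw).symm
  push Not at hin
  by_cases hsat : ∀ w, π ⁻¹' {w} ⊆ X ∨ X ∩ π ⁻¹' {w} = ∅
  · have hX : X = π ⁻¹' (π '' X) := by
      refine (Set.subset_preimage_image π X).antisymm ?_
      rintro a ⟨b, hb, hba⟩
      rcases hsat (π b) with h | h
      · exact h hba.symm
      · exact (h.subset ⟨hb, rfl⟩).elim
    rw [hX, hunion, ← hQ]
    exact Iff.rfl
  · push Not at hsat
    obtain ⟨w, hw, hw'⟩ := hsat
    -- `X` crosses the fiber of `w`, so the support property keeps it out of `F`. As a clone set of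
    -- `R` it would make its trace on the fiber a cut, and its remaining image a neighbor of `w`,
    -- with the same pattern.
    refine ⟨fun hX => ?_, fun hX => (hSQ w {i | ∀ x ∈ X, π x ≠ w → Prefers Q i (π x) w} ?_ ?_).elim⟩
    · rcases (hsupp w).2 X hX (hin w) with h | h
      exacts [(hw h).elim, (hw'.ne_empty h).elim]
    all_goals
      obtain ⟨b, hbw, hbX⟩ := Set.not_subset.1 hw
      obtain ⟨a, haX, haw⟩ := hw'
      obtain ⟨x, hxX, hxw⟩ := Set.not_subset.1 (hin w)
      have hbw : π b = w := hbw
      have haw : π a = w := haw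
      have hxw : π x ≠ w := hxw
      -- Members of `X` inside and outside the fiber rank alike against `b`, and an outside one is
      -- compared with `b` through the quotient.
      have key : ∀ a ∈ X, ∀ b, b ∉ X → π b = w → ∀ x ∈ X, π x ≠ w → ∀ i,
          Prefers R i a b ↔ Prefers Q i (π x) w := by
        intro a haX b hbX hbw x hxX hxw i
        rw [hX.2 a haX x hxX b hbX i, hRQ i (by rwa [hbw]), hbw]
      have key' : ∀ x ∈ X, π x ≠ w → ∀ i,
          Prefers Q i (π x) w ↔ ∀ x ∈ X, π x ≠ w → Prefers Q i (π x) w := by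
        intro x hxX hxw i
        refine ⟨fun h y hyX hyw => ?_, fun h => h x hxX hxw⟩
        rw [← key a haX b hbX hbw y hyX hyw i]
        exact (key a haX b hbX hbw x hxX hxw i).2 h
    · refine ⟨π '' X \ {w}, ⟨π x, ⟨x, hxX, rfl⟩, hxw⟩, fun h => h.2 rfl, ?_, ?_⟩
      · rw [Set.insert_sdiff_singleton, Set.insert_eq_of_mem (show w ∈ π '' X from ⟨a, haX, haw⟩)]
        refine ⟨⟨_, x, hxX, rfl⟩, ?_⟩
        rintro _ ⟨c, hc, rfl⟩ _ ⟨c', hc', rfl⟩ d hd i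
        obtain ⟨d, rfl⟩ := hπ d
        have hdX : ∀ c ∈ X, π c ≠ π d := fun c hc h => hd ⟨c, hc, h⟩
        rw [← hRQ i (hdX c hc), ← hRQ i (hdX c' hc')]
        exact hX.2 c hc c' hc' d (fun h => hdX d h rfl) i
      · rintro _ ⟨⟨y, hyX, rfl⟩, hyw⟩ i
        exact key' y hyX hyw i
    · refine ⟨Subtype.val ⁻¹' X, ⟨⟨a, haw⟩, haX⟩, ⟨⟨b, hbw⟩, hbX⟩, fun c hc d hd i => ?_⟩
      rw [← hRS, key c.1 hc d.1 hd d.2 x hxX hxw i]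
      exact key' x hxX hxw i

end Assemble

/-! ### Subfamilies and quotients of clone structures -/

section Comap

variable {V W : Type u} {n : ℕ}

/-- The profile on `W` that results from `R` along an injective map `W → V`. -/
abbrev Profile.comap (R : Profile V n) (f : W → V) (hf : f.Injective) : Profile W n :=
  fun i => @LinearOrder.lift' W V (R i) f hf

/-- Candidates outside the clone set `E` cannot tell its members apart, so only those inside `E`
need testing. -/
theorem restrict_clones (R : Profile V n) {E : Set V} (hE : E ∈ clones R) :
    restrict (clones R) E = clones (Profile.comap R (Subtype.val : E → V)
      Subtype.val_injective) := by
  ext Y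
  change Subtype.val '' Y ∈ clones R ↔ _
  constructor
  · rintro ⟨hne, h⟩
    refine ⟨Set.image_nonempty.1 hne, fun c hc c' hc' a ha i => ?_⟩
    exact h c ⟨c, hc, rfl⟩ c' ⟨c', hc', rfl⟩ a
      (fun ⟨b, hb, hba⟩ => ha (Subtype.ext hba ▸ hb)) i
  · rintro ⟨hne, h⟩
    refine ⟨hne.image _, ?_⟩
    rintro _ ⟨c, hc, rfl⟩ _ ⟨c', hc', rfl⟩ a ha i
    by_cases haE : a ∈ E
    · exact h c hc c' hc' ⟨a, haE⟩ (fun h' => ha ⟨_, h', rfl⟩) i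
    · exact hE.2 c c.2 c' c'.2 a haE i

theorem IsCloneStructure.restrict {F : Set (Set V)} (hF : IsCloneStructure F) {E : Set V}
    (hE : E ∈ F) : IsCloneStructure (restrict F E) := by
  obtain ⟨n, hn, R, rfl⟩ := hF
  exact ⟨n, hn, _, restrict_clones R hE⟩

/-- When fibers are clone sets, comparing candidates of different fibers depends only on the fibers.
One representative per fiber, chosen by a section of `π`, thus gives a profile for the quotient. -/
theorem IsCloneStructure.quotient {F : Set (Set V)} (hF : IsCloneStructure F) {π : V → W}
    (hπ : π.Surjective) (hfib : ∀ w, π ⁻¹' {w} ∈ F) : IsCloneStructure {Y | π ⁻¹' Y ∈ F} := by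
  obtain ⟨n, hn, R, rfl⟩ := hF
  obtain ⟨s, hs⟩ := hπ.hasRightInverse
  refine ⟨n, hn, Profile.comap R s hs.injective, Set.ext fun Y => ?_⟩
  change π ⁻¹' Y ∈ clones R ↔ _
  constructor
  · rintro ⟨⟨v, hv⟩, h⟩
    have hmem : ∀ w, s w ∈ π ⁻¹' Y ↔ w ∈ Y := fun w => by rw [Set.mem_preimage, hs w]
    exact ⟨⟨_, hv⟩, fun c hc c' hc' a ha i => h (s c) ((hmem c).2 hc) (s c') ((hmem c').2 hc')
      (s a) (fun h' => ha ((hmem a).1 h')) i⟩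
  · rintro ⟨⟨w, hw⟩, h⟩
    obtain ⟨v, rfl⟩ := hπ w
    have key : ∀ c a, π c ≠ π a → ∀ i, Prefers R i c a ↔ Prefers R i (s (π c)) (s (π a)) := by
      intro c a hca i
      rw [(hfib (π c)).2 c rfl (s (π c)) (hs _) a hca.symm i]
      exact prefers_congr_right (hfib (π a)) rfl (hs _) (by simpa [hs (π c)] using hca) i
    refine ⟨⟨v, hw⟩, fun c hc c' hc' a ha i => ?_⟩
    rw [key c a (fun e => ha (show π a ∈ Y from e ▸ hc)) i,
      key c' a (fun e => ha (show π a ∈ Y from e ▸ hc')) i]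
    exact h _ hc _ hc' _ ha i

end Comap

/-! ### The decomposition -/

section Decomposition

variable {V : Type u} {F : Set (Set V)}

theorem isSupport_restrict {E D : Set V} (hD : IsSupport F D) (hDE : D ⊆ E) :
    IsSupport (restrict F E) (Subtype.val ⁻¹' D) := by
  have himg : (Subtype.val '' (Subtype.val ⁻¹' D : Set E)) = D := by
    rw [Subtype.image_preimage_coe, Set.inter_eq_right.2 hDE]
  refine ⟨by rw [CloneStructures.restrict, Set.mem_ofPred_eq, himg]; exact hD.1,
    fun Y hY hYD => ?_⟩
  rcases hD.2 _ hY (fun h => hYD (Set.image_subset_iff.1 h)) with h | h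
  · refine Or.inl fun x hx => ?_
    obtain ⟨y, hy, hyx⟩ := h hx
    rwa [← Subtype.ext hyx]
  · refine Or.inr (Set.eq_empty_of_forall_notMem fun x hx => ?_)
    exact (h.subset ⟨⟨x, hx.1, rfl⟩, hx.2⟩).elim

theorem IsSupport.of_restrict {E : Set V} {D : Set E} (hE : IsSupport F E)
    (hD : IsSupport (restrict F E) D) : IsSupport F (Subtype.val '' D) := by
  refine ⟨hD.1, fun X hX hXD => ?_⟩
  by_cases hXE : X ⊆ E
  · obtain ⟨Y, rfl⟩ : ∃ Y : Set E, X = Subtype.val '' Y :=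
      ⟨Subtype.val ⁻¹' X, by rw [Subtype.image_preimage_coe, Set.inter_eq_right.2 hXE]⟩
    rcases hD.2 Y hX (fun h => hXD (Set.image_mono h)) with h | h
    · exact Or.inl (Set.image_mono h)
    · exact Or.inr (by rw [← Set.image_inter Subtype.val_injective, h, Set.image_empty])
  · have hsub : Subtype.val '' D ⊆ E := Subtype.coe_image_subset E D
    rcases hE.2 X hX hXE with h | h
    · exact Or.inl (hsub.trans h)
    · exact Or.inr (Set.subset_eq_empty (Set.inter_subset_inter_right X hsub) h)

/-- Intersecting supports are nested, and a strictly smaller nontrivial one would contradict the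
irreducibility of the larger. -/
theorem eq_of_mem_decomposition {E D : Set V} (hE : E ∈ decomposition F)
    (hD : D ∈ decomposition F) {a : V} (haE : a ∈ E) (haD : a ∈ D) : E = D := by
  have key : ∀ {E D : Set V}, E ∈ decomposition F → D ∈ decomposition F → D ⊆ E → E ⊆ D := by
    intro E D hE hD hDE
    by_contra hED
    refine hE.2.2 ⟨Subtype.val ⁻¹' D, ?_, ?_, isSupport_restrict hD.2.1 hDE⟩
    · obtain ⟨x, hx, y, hy, hxy⟩ := hD.1
      exact ⟨⟨x, hDE hx⟩, hx, ⟨y, hDE hy⟩, hy, fun h => hxy (congrArg Subtype.val h)⟩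
    · intro h
      exact hED fun x hx => (h.symm.subset (Set.mem_univ (⟨x, hx⟩ : E)) :)
  by_cases hDE : D ⊆ E
  · exact (key hE hD hDE).antisymm hDE
  · rcases hE.2.1.2 D hD.2.1.1 hDE with h | h
    · exact h.antisymm (key hD hE h)
    · exact (h.subset ⟨haD, haE⟩).elim

/-- A minimal nontrivial support is irreducible, because a support inside a support is again a
support of `F`. -/
theorem decomposition_nonempty [Finite V] (h : ¬ Irreducible F) : (decomposition F).Nonempty := by
  obtain ⟨E, hE⟩ := not_not.1 h
  obtain ⟨D, hD⟩ := (Set.toFinite {E : Set V | E.Nontrivial ∧ IsSupport F E}).exists_minimal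
    ⟨E, hE.1, hE.2.2⟩
  refine ⟨D, hD.prop.1, hD.prop.2, ?_⟩
  rintro ⟨C, hC, hCne, hCs⟩
  refine hCne (Set.eq_univ_of_forall fun x => ?_)
  obtain ⟨y, hy, hyx⟩ := hD.le_of_le
    (y := Subtype.val '' C) ⟨hC.image Subtype.val_injective, IsSupport.of_restrict hD.prop.2 hCs⟩
    (Subtype.coe_image_subset D C) x.2
  rwa [← Subtype.ext hyx]

theorem ne_univ_of_mem_decomposition (h : ¬ Irreducible F) {E : Set V}
    (hE : E ∈ decomposition F) : E ≠ Set.univ := by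
  rintro rfl
  obtain ⟨D, hD, hDne, hDs⟩ := not_not.1 h
  refine hE.2.2 ⟨Subtype.val ⁻¹' D, ?_, ?_, isSupport_restrict hDs (Set.subset_univ D)⟩
  · obtain ⟨x, hx, y, hy, hxy⟩ := hD
    exact ⟨⟨x, trivial⟩, hx, ⟨y, trivial⟩, hy, fun h => hxy (congrArg Subtype.val h)⟩
  · intro h
    exact hDne (Set.eq_univ_of_forall fun x =>
      (h.symm.subset (Set.mem_univ (⟨x, trivial⟩ : (Set.univ : Set V))) :))

open Classical in
/-- The map that collapses each set of the decomposition. -/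
noncomputable def toCollapsed (F : Set (Set V)) (a : V) : Collapsed F :=
  if h : ∃ E, E ∈ decomposition F ∧ a ∈ E then Sum.inr ⟨h.choose, h.choose_spec.1⟩
  else Sum.inl ⟨a, fun E hE ha => h ⟨E, hE, ha⟩⟩

theorem toCollapsed_eq_inr_iff {a : V} {E : {E : Set V // E ∈ decomposition F}} :
    toCollapsed F a = Sum.inr E ↔ a ∈ E.1 := by
  unfold toCollapsed
  split_ifs with h
  · rw [Sum.inr.injEq]
    constructor
    · rintro rfl
      exact h.choose_spec.2
    · exact fun ha => Subtype.ext (eq_of_mem_decomposition h.choose_spec.1 E.2 h.choose_spec.2 ha)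
  · exact ⟨fun h' => by simp at h', fun ha => (h ⟨E.1, E.2, ha⟩).elim⟩

theorem toCollapsed_eq_inl_iff {a : V} {b : {a : V // ∀ E ∈ decomposition F, a ∉ E}} :
    toCollapsed F a = Sum.inl b ↔ a = b.1 := by
  unfold toCollapsed
  split_ifs with h
  · refine ⟨fun h' => by simp at h', ?_⟩
    rintro rfl
    obtain ⟨E, hE, hb⟩ := h
    exact (b.2 E hE hb).elim
  · rw [Sum.inl.injEq]
    exact ⟨fun h' => congrArg Subtype.val h', fun h' => Subtype.ext h'⟩

theorem toCollapsed_preimage_inr (E : {E : Set V // E ∈ decomposition F}) :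
    toCollapsed F ⁻¹' {Sum.inr E} = E.1 :=
  Set.ext fun _ => toCollapsed_eq_inr_iff

theorem toCollapsed_preimage_inl (b : {a : V // ∀ E ∈ decomposition F, a ∉ E}) :
    toCollapsed F ⁻¹' {Sum.inl b} = {b.1} :=
  Set.ext fun _ => toCollapsed_eq_inl_iff

theorem toCollapsed_surjective (F : Set (Set V)) : (toCollapsed F).Surjective := by
  rintro (b | E)
  · exact ⟨b.1, toCollapsed_eq_inl_iff.2 rfl⟩
  · obtain ⟨x, hx⟩ := E.2.1.nonempty
    exact ⟨x, toCollapsed_eq_inr_iff.2 hx⟩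

theorem mem_collapseSet_iff {X : Set V} {s : Collapsed F} :
    s ∈ collapseSet F X ↔ toCollapsed F ⁻¹' {s} ⊆ X := by
  rcases s with b | E
  · rw [toCollapsed_preimage_inl, Set.singleton_subset_iff]
    exact Iff.rfl
  · rw [toCollapsed_preimage_inr]
    exact Iff.rfl

/-- A member of `F` not properly inside a decomposition set contains or avoids each such set, hence
is a union of fibers of `toCollapsed F`. Collapsing is thus a quotient in the sense needed for
gluing. -/
theorem collapse_eq (hF : ∀ X ∈ F, X.Nonempty) : collapse F = {Y | toCollapsed F ⁻¹' Y ∈ F} := by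
  ext Y
  constructor
  · rintro ⟨X, hX, hXE, rfl⟩
    have : toCollapsed F ⁻¹' collapseSet F X = X := by
      ext a
      rw [Set.mem_preimage, mem_collapseSet_iff]
      refine ⟨fun h => h rfl, fun ha => ?_⟩
      rcases hs : toCollapsed F a with b | E
      · rw [toCollapsed_preimage_inl, Set.singleton_subset_iff, ← toCollapsed_eq_inl_iff.1 hs]
        exact ha
      · rw [toCollapsed_preimage_inr]
        have haE := toCollapsed_eq_inr_iff.1 hs
        by_cases hsub : X ⊆ E.1
        · by_contra h
          exact hXE E.1 E.2 ⟨hsub, h⟩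
        · rcases E.2.2.1.2 X hX hsub with h | h
          · exact h
          · exact (h.subset ⟨ha, haE⟩).elim
    rw [Set.mem_ofPred_eq, this]
    exact hX
  · intro hY
    refine ⟨_, hY, fun E hE hss => ?_, Set.ext fun s => ?_⟩
    · obtain ⟨x, hx⟩ := hF _ hY
      refine hss.2 fun y hy => ?_
      have e₁ := (toCollapsed_eq_inr_iff (E := ⟨E, hE⟩)).2 (hss.1 hx)
      have e₂ := (toCollapsed_eq_inr_iff (E := ⟨E, hE⟩)).2 hy
      rw [Set.mem_preimage, e₁] at hx
      rwa [Set.mem_preimage, e₂]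
    · rw [mem_collapseSet_iff]
      obtain ⟨a, rfl⟩ := toCollapsed_surjective F s
      exact ⟨fun h b hb => by rwa [Set.mem_preimage, show toCollapsed F b = _ from hb],
        fun h => h rfl⟩

theorem isSupport_toCollapsed_preimage {n : ℕ} {R : Profile V n} (s : Collapsed (clones R)) :
    IsSupport (clones R) (toCollapsed (clones R) ⁻¹' {s}) := by
  rcases s with b | E
  · rw [toCollapsed_preimage_inl]
    refine ⟨singleton_mem_clones R _, fun X _ _ => ?_⟩
    rw [Set.singleton_subset_iff, ← Set.disjoint_iff_inter_eq_empty,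
      Set.disjoint_singleton_right]
    exact em _
  · rw [toCollapsed_preimage_inr]
    exact E.2.2.1

theorem IsCloneStructure.isSupport_toCollapsed_preimage (hF : IsCloneStructure F)
    (s : Collapsed F) : IsSupport F (toCollapsed F ⁻¹' {s}) := by
  obtain ⟨n, hn, R, rfl⟩ := hF
  exact CloneStructures.isSupport_toCollapsed_preimage s

theorem IsCloneStructure.collapse_eq (hF : IsCloneStructure F) :
    collapse F = {Y | toCollapsed F ⁻¹' Y ∈ F} := by
  obtain ⟨n, hn, R, rfl⟩ := hF
  exact CloneStructures.collapse_eq fun X hX => hX.1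

theorem IsCloneStructure.collapse (hF : IsCloneStructure F) : IsCloneStructure (collapse F) := by
  rw [hF.collapse_eq]
  exact hF.quotient (toCollapsed_surjective F) fun s => (hF.isSupport_toCollapsed_preimage s).1

end Decomposition

/-! ### Irreducible clone structures -/

section Irreducible

variable {V : Type u} {n : ℕ} {R : Profile V n}

/-- A maximal proper nontrivial clone set is not a support, so some clone set `Y` crosses it. By
maximality their union is everything, and the complement is the difference of two crossing clone
sets. -/
theorem exists_cut [Finite V] [Nonempty V] (hirr : Irreducible (clones R))
    (hfat : ¬ IsFat (clones R)) : ∃ P ∈ clones R, Pᶜ ∈ clones R := by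
  rw [isFat_clones_iff] at hfat
  push Not at hfat
  obtain ⟨X₀, hX₀, hnt, hne⟩ := hfat
  obtain ⟨X, hX⟩ := (Set.toFinite {X | X ∈ clones R ∧ X.Nontrivial ∧ X ≠ Set.univ}).exists_maximal
    ⟨X₀, hX₀, hnt, hne⟩
  obtain ⟨hXc, hXnt, hXne⟩ := hX.prop
  have hns : ¬ IsSupport (clones R) X := fun h => hirr ⟨X, hXnt, hXne, h⟩
  obtain ⟨Y, hY, hYX, hXY, hYX'⟩ : ∃ Y ∈ clones R, ¬ Y ⊆ X ∧ ¬ X ⊆ Y ∧ Y ∩ X ≠ ∅ := by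
    by_contra! h
    refine hns ⟨hXc, fun Y hY hYX => ?_⟩
    by_contra! h'
    exact h'.2.ne_empty (h Y hY hYX h'.1)
  have hne : (X ∩ Y).Nonempty := by
    rw [Set.inter_comm]
    exact Set.nonempty_iff_ne_empty.2 hYX'
  have huniv : X ∪ Y = Set.univ := by
    by_contra h
    refine hYX (Set.subset_union_right.trans (hX.le_of_ge
      ⟨union_mem_clones hXc hY hne, hXnt.mono Set.subset_union_left, h⟩ Set.subset_union_left))
  have hcompl : Y \ X = Xᶜ := by
    ext a
    have := huniv.symm.subset (Set.mem_univ a)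
    simp only [Set.mem_sdiff, Set.mem_compl_iff, Set.mem_union] at this ⊢
    tauto
  refine ⟨X, hXc, ?_⟩
  rw [← hcompl]
  exact diff_mem_clones hY hXc (Set.sdiff_nonempty.2 hYX) (Set.sdiff_nonempty.2 hXY)

/-- In an irreducible family with more clone sets than a fat sausage, any two candidates are
separated by a partition into two clone sets. -/
theorem exists_cut_separating [Finite V] [Nonempty V] (hirr : Irreducible (clones R))
    (hfat : ¬ IsFat (clones R)) {x y : V} (hxy : x ≠ y) :
    ∃ P ∈ clones R, Pᶜ ∈ clones R ∧ x ∈ P ∧ y ∉ P := by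
  by_contra! hnone
  -- `⋂₀ G` is a block of candidates that no cut separates. If `x` and `y` were both in it, it would
  -- be a forbidden support.
  let G : Set (Set V) := {P | P ∈ clones R ∧ Pᶜ ∈ clones R ∧ x ∈ P}
  have hB : ⋂₀ G ∈ clones R := sInter_mem_clones (fun P hP => hP.1) ⟨x, fun P hP => hP.2.2⟩
  have hcut : ∀ P ∈ clones R, Pᶜ ∈ clones R → ∀ a ∈ ⋂₀ G, ∀ b ∈ ⋂₀ G, a ∈ P → b ∈ P := by
    intro P hP hP' a ha b hb haP
    by_cases hxP : x ∈ P
    · exact hb P ⟨hP, hP', hxP⟩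
    · exact (ha Pᶜ ⟨hP', by rwa [compl_compl], hxP⟩ haP).elim
  refine hirr ⟨⋂₀ G, ⟨x, fun P hP => hP.2.2, y, fun P hP => hnone P hP.1 hP.2.1 hP.2.2, hxy⟩,
    fun huniv => ?_, hB, fun Y hY hYB => ?_⟩
  · obtain ⟨P, hP, hP'⟩ := exists_cut hirr hfat
    obtain ⟨a, ha⟩ := hP.1
    obtain ⟨b, hb⟩ := hP'.1
    rw [huniv] at hcut
    exact hb (hcut P hP hP' a trivial b trivial ha)
  · by_contra! h
    obtain ⟨hBY, ⟨a, haY, haB⟩⟩ := h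
    obtain ⟨b, hbB, hbY⟩ := Set.not_subset.1 hBY
    obtain ⟨c, hcY, hcB⟩ := Set.not_subset.1 hYB
    obtain ⟨P, hP, hcP⟩ : ∃ P ∈ G, c ∉ P := by
      by_contra! h
      exact hcB h
    -- If `Y` crosses the block, then `P \ Y` and its complement `Pᶜ ∪ Y` form a cut separating `b`
    -- from `a` within the block.
    have h₁ : P \ Y ∈ clones R := diff_mem_clones hP.1 hY ⟨b, hbB P hP, hbY⟩ ⟨c, hcY, hcP⟩
    have h₂ : (P \ Y)ᶜ ∈ clones R := by
      rw [Set.sdiff_eq, Set.compl_inter, compl_compl]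
      exact union_mem_clones hP.2.1 hY ⟨c, hcP, hcY⟩
    exact (hcut _ h₁ h₂ b hbB a haB ⟨hbB P hP, hbY⟩).2 haY

/-- An irreducible clone structure is a fat sausage or the string of sausages along the order of
any of the voters. -/
theorem isStringAlong_of_irreducible [Finite V] [Nonempty V] (hirr : Irreducible (clones R))
    (hfat : ¬ IsFat (clones R)) (hn : 1 ≤ n) :
    ∃ c : Fin (Nat.card V) ≃ V, IsStringAlong c (clones R) := by
  let i : Fin n := ⟨0, hn⟩
  have := Fintype.ofFinite V
  let := R i
  let c : Fin (Nat.card V) ≃o V := Fintype.orderIsoFinOfCardEq V Nat.card_eq_fintype_card.symm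
  -- For `x < y`, the part containing `x` of a cut separating `x` from `y` contains everything below
  -- `x`: otherwise `x` would lie between two members of the other part.
  have hIic : ∀ x : V, Set.Iic x ∈ clones R := by
    intro x
    have : Set.Iic x = ⋂₀ {P | P ∈ clones R ∧ Set.Iic x ⊆ P} := by
      refine (Set.subset_sInter fun P hP => hP.2).antisymm fun y hy => ?_
      by_contra hyx
      have hxy : x < y := not_le.1 hyx
      obtain ⟨P, hP, hP', hxP, hyP⟩ := exists_cut_separating hirr hfat hxy.ne
      refine hyP (hy P ⟨hP, fun z hz => ?_⟩)
      by_contra hzP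
      rcases (show z ≤ x from hz).lt_or_eq with h | rfl
      · exact between_mem hP' (i := i) hzP hyP hxy h hxP
      · exact hzP hxP
    rw [this]
    refine sInter_mem_clones (fun P hP => hP.1) ⟨x, fun P hP => hP.2 le_rfl⟩
  have hIci : ∀ x : V, Set.Ici x ∈ clones R := by
    intro x
    have : Set.Ici x = ⋂₀ {P | P ∈ clones R ∧ Set.Ici x ⊆ P} := by
      refine (Set.subset_sInter fun P hP => hP.2).antisymm fun y hy => ?_
      by_contra hyx
      have hxy : y < x := not_le.1 hyx
      obtain ⟨P, hP, hP', hxP, hyP⟩ := exists_cut_separating hirr hfat hxy.ne'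
      refine hyP (hy P ⟨hP, fun z hz => ?_⟩)
      by_contra hzP
      rcases (show x ≤ z from hz).lt_or_eq with h | rfl
      · exact between_mem hP' (i := i) hyP hzP h hxy hxP
      · exact hzP hxP
    rw [this]
    refine sInter_mem_clones (fun P hP => hP.1) ⟨x, fun P hP => hP.2 le_rfl⟩
  refine ⟨c.toEquiv, Set.ext fun X => ⟨fun hX => ?_, ?_⟩⟩
  · obtain ⟨a, ha⟩ := (Set.toFinite X).exists_minimal hX.1
    obtain ⟨b, hb⟩ := (Set.toFinite X).exists_maximal hX.1
    have ha' : ∀ x ∈ X, a ≤ x := fun x hx => (le_total a x).elim id fun h => ha.le_of_le hx h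
    have hb' : ∀ x ∈ X, x ≤ b := fun x hx => (le_total x b).elim id fun h => hb.le_of_ge hx h
    refine ⟨c.symm a, c.symm b, c.symm.monotone (ha' b hb.prop), ?_⟩
    have : c.toEquiv '' Set.Icc (c.symm a) (c.symm b) = Set.Icc a b := by
      simp
    rw [this]
    refine Set.Subset.antisymm (fun x hx => ⟨ha' x hx, hb' x hx⟩) fun x hx => ?_
    rcases hx.1.lt_or_eq with h₁ | rfl
    · rcases hx.2.lt_or_eq with h₂ | rfl
      · exact between_mem hX (i := i) ha.prop hb.prop h₂ h₁
      · exact hb.prop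
    · exact ha.prop
  · rintro ⟨p, q, hpq, rfl⟩
    have : c.toEquiv '' Set.Icc p q = Set.Iic (c q) ∩ Set.Ici (c p) := by
      rw [Set.inter_comm, Set.Ici_inter_Iic]
      exact c.image_Icc p q
    rw [this]
    exact inter_mem_clones (hIic _) (hIci _) ⟨c p, c.monotone hpq, le_rfl⟩

theorem three_le_card_of_not_isFat [Finite V] [Nonempty V] (hfat : ¬ IsFat (clones R)) :
    3 ≤ Nat.card V := by
  rw [isFat_clones_iff] at hfat
  push Not at hfat
  obtain ⟨X, -, hnt, hne⟩ := hfat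
  have h₁ : 1 < X.ncard := Set.one_lt_ncard_iff_nontrivial.2 hnt
  have h₂ : X.ncard < Nat.card V := by
    rw [← Set.ncard_univ]
    exact Set.ncard_lt_ncard (Set.ssubset_univ_iff.2 hne)
  omega

end Irreducible

/-! ### Existence of PQ-trees -/

theorem exists_isPQTree {V : Type u} [Finite V] [Nonempty V] {F : Set (Set V)}
    (hF : IsCloneStructure F) : ∃ T : PQTree V, IsPQTree F T := by
  induction hN : Nat.card V using Nat.strong_induction_on generalizing V with
  | _ N ih =>
  subst hN
  by_cases hred : Irreducible F
  · obtain ⟨n, hn, R, rfl⟩ := hF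
    by_cases hfat : IsFat (clones R)
    · by_cases hcard : 2 ≤ Nat.card V
      · exact ⟨_, .fat hred hfat hcard (Finite.equivFin V).symm⟩
      · obtain ⟨a⟩ := ‹Nonempty V›
        have : Subsingleton V := Finite.card_le_one_iff_subsingleton.1 (by omega)
        exact ⟨_, .single a (fun b => Subsingleton.elim b a) hfat⟩
    · obtain ⟨c, hc⟩ := isStringAlong_of_irreducible hred hfat hn
      exact ⟨_, .string hred (three_le_card_of_not_isFat hfat) c hc⟩
  · have hsub : ∀ E : {E : Set V // E ∈ decomposition F}, ∃ T, IsPQTree (restrict F E.1) T := by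
      intro E
      have : Nonempty E.1 := E.2.1.nonempty.to_subtype
      have hlt : Nat.card E.1 < Nat.card V := by
        rw [Nat.card_coe_set_eq, ← Set.ncard_univ]
        exact Set.ncard_lt_ncard (Set.ssubset_univ_iff.2 (ne_univ_of_mem_decomposition hred E.2))
      exact ih _ hlt (hF.restrict E.2.2.1.1) rfl
    choose S hS using hsub
    -- The collapse is strictly smaller because some decomposition set exists and merges at least
    -- two candidates.
    have hlt : Nat.card (Collapsed F) < Nat.card V := by
      refine (Nat.card_le_card_of_surjective _ (toCollapsed_surjective F)).lt_of_ne fun h => ?_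
      have hinj := ((Nat.bijective_iff_surjective_and_card _).2
        ⟨toCollapsed_surjective F, h.symm⟩).injective
      obtain ⟨E, hE⟩ := decomposition_nonempty hred
      obtain ⟨x, hx, y, hy, hxy⟩ := hE.1
      exact hxy (hinj ((toCollapsed_eq_inr_iff (E := ⟨E, hE⟩).2 hx).trans
        (toCollapsed_eq_inr_iff (E := ⟨E, hE⟩).2 hy).symm))
    have : Nonempty (Collapsed F) := ⟨toCollapsed F (Classical.arbitrary V)⟩
    obtain ⟨T, hT⟩ := ih _ hlt hF.collapse rfl
    exact ⟨_, .reducible hred S hS T hT⟩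

/-! ### Implementing strings of sausages and fat sausages -/

section Sausages

variable {V : Type u} {k : ℕ}

theorem implementable_of_isStringAlong {F : Set (Set V)} {m : ℕ} {c : Fin m ≃ V}
    (hF : IsStringAlong c F) (hk : 1 ≤ k) : Implementable k F := by
  let R : Profile V k := fun _ => LinearOrder.lift' c.symm c.symm.injective
  have hR : ∀ i (a b : V), Prefers R i a b ↔ c.symm b < c.symm a := fun _ _ _ => Iff.rfl
  let i₀ : Fin k := ⟨0, hk⟩
  refine ⟨R, hF.trans (Set.ext fun X => ⟨?_, fun hX => ?_⟩)⟩
  · rintro ⟨p, q, hpq, rfl⟩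
    refine mem_clones_iff.2 ⟨⟨c p, p, ⟨le_rfl, hpq⟩, rfl⟩, ?_⟩
    rintro i _ ⟨a, ha, rfl⟩ _ ⟨b, hb, rfl⟩ x h₁ h₂
    rw [hR, c.symm_apply_apply] at h₁ h₂
    exact ⟨c.symm x, ⟨ha.1.trans h₂.le, h₁.le.trans hb.2⟩, c.apply_symm_apply x⟩
  · obtain ⟨x₀, hx₀⟩ := hX.1
    have hY : (c ⁻¹' X).Nonempty := ⟨c.symm x₀, by simpa using hx₀⟩
    obtain ⟨p, hp⟩ := (Set.toFinite (c ⁻¹' X)).exists_minimal hY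
    obtain ⟨q, hq⟩ := (Set.toFinite (c ⁻¹' X)).exists_maximal hY
    have hp' : ∀ x ∈ c ⁻¹' X, p ≤ x := fun x hx => (le_total p x).elim id fun h => hp.le_of_le hx h
    have hq' : ∀ x ∈ c ⁻¹' X, x ≤ q := fun x hx => (le_total x q).elim id fun h => hq.le_of_ge hx h
    refine ⟨p, q, hp' q hq.prop, Set.Subset.antisymm (fun x hx => ?_) ?_⟩
    · have hx' : c.symm x ∈ c ⁻¹' X := by simpa using hx
      exact ⟨c.symm x, ⟨hp' _ hx', hq' _ hx'⟩, c.apply_symm_apply x⟩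
    · rintro _ ⟨x, hx, rfl⟩
      rcases hx.1.lt_or_eq with h₁ | rfl
      · rcases hx.2.lt_or_eq with h₂ | rfl
        · refine between_mem hX (i := i₀) hp.prop hq.prop ?_ ?_ <;>
            rw [hR, c.symm_apply_apply, c.symm_apply_apply] <;> assumption
        · exact hq.prop
      · exact hp.prop

theorem implementable_of_isFat [Nonempty V] {F : Set (Set V)} (hF : IsFat F) {R : Profile V k}
    (hR : ∀ X ∈ clones R, X.Nontrivial → X = Set.univ) : Implementable k F :=
  ⟨R, Eq.trans hF (isFat_clones_iff.2 hR).symm⟩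

theorem implementable_of_card_le_two [Finite V] [Nonempty V] {F : Set (Set V)} (hF : IsFat F)
    (hV : Nat.card V ≤ 2) (k : ℕ) : Implementable k F := by
  refine implementable_of_isFat hF
    (R := fun _ => LinearOrder.lift' (Finite.equivFin V) (Finite.equivFin V).injective)
    fun X _ hnt => Set.eq_of_subset_of_ncard_le (Set.subset_univ X) ?_
  rw [Set.ncard_univ]
  have h₁ : 1 < X.ncard := Set.one_lt_ncard_iff_nontrivial.2 hnt
  omega

theorem implementable_of_keys [Nonempty V] {F : Set (Set V)} (hF : IsFat F) {m : ℕ}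
    (c : Fin m ≃ V) (f : Fin k → Fin m → ℕ) (hf : ∀ i, (f i).Injective)
    (h : ∀ Y : Set (Fin m), Y.Nontrivial → (∀ i, ∀ a ∈ Y, ∀ b ∈ Y, ∀ x, f i a < f i x →
      f i x < f i b → x ∈ Y) → ∀ x, x ∈ Y) : Implementable k F := by
  refine implementable_of_isFat hF
    (R := fun i => LinearOrder.lift' (f i ∘ c.symm) ((hf i).comp c.symm.injective))
    fun X hX hnt => Set.eq_univ_of_forall fun x => ?_
  have := h (c ⁻¹' X) ?_ ?_ (c.symm x)
  · simpa using this
  · exact hnt.preimage c.surjective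
  · intro i a ha b hb x h₁ h₂
    refine between_mem hX (i := i) (a := c a) (b := c b) ha hb ?_ ?_
    · change f i (c.symm (c x)) < f i (c.symm (c b))
      simpa using h₂
    · change f i (c.symm (c a)) < f i (c.symm (c x))
      simpa using h₁

/-- Sorting by this key lists the odd numbers below `m` in increasing order, then `0`, and then
the positive even numbers in decreasing order. -/
def interleaveKey (m v : ℕ) : ℕ :=
  if v % 2 = 1 then v else if v = 0 then m else 3 * m - v

theorem interleaveKey_injOn (m : ℕ) {v w : ℕ} (hv : v < m) (hw : w < m)
    (h : interleaveKey m v = interleaveKey m w) : v = w := by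
  unfold interleaveKey at h
  split_ifs at h <;> omega

/-- For `m ≥ 4` the natural order of `{0, …, m - 1}` and the order by `interleaveKey` have no
common intervals except the trivial ones. -/
theorem mem_of_common_interval {m : ℕ} (hm : 4 ≤ m) {Y : Set ℕ} (hYm : ∀ a ∈ Y, a < m)
    (hY : Y.Nontrivial) (h₁ : ∀ a ∈ Y, ∀ b ∈ Y, ∀ x, a < x → x < b → x ∈ Y)
    (h₂ : ∀ a ∈ Y, ∀ b ∈ Y, ∀ x < m, interleaveKey m a < interleaveKey m x →
      interleaveKey m x < interleaveKey m b → x ∈ Y) : ∀ x < m, x ∈ Y := by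
  obtain ⟨a, ha, b, hb, hab⟩ := hY.exists_lt
  -- Two consecutive numbers in `Y` provide an odd and an even member.
  have ha' : a + 1 ∈ Y := by
    rcases (Nat.succ_le_of_lt hab).lt_or_eq with h | h
    · exact h₁ a ha b hb _ (Nat.lt_succ_self a) h
    · exact (show a + 1 = b from h) ▸ hb
  obtain ⟨o, ho, e, he, ho2, he2⟩ : ∃ o ∈ Y, ∃ e ∈ Y, o % 2 = 1 ∧ e % 2 = 0 := by
    rcases Nat.mod_two_eq_zero_or_one a with h | h
    · exact ⟨a + 1, ha', a, ha, by omega, h⟩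
    · exact ⟨a, ha, a + 1, ha', h, by omega⟩
  have hom := hYm o ho
  have hem := hYm e he
  -- Odd keys are below `m` and positive even keys above `2 * m`, so `0`, with key `m`, lies between
  -- `o` and `e` unless `e = 0`.
  have hzero : 0 ∈ Y := by
    rcases Nat.eq_zero_or_pos e with rfl | hpos
    · exact he
    · refine h₂ o ho e he 0 (by omega) ?_ ?_ <;> unfold interleaveKey <;> split_ifs <;> first | omega | contradiction
  have hodd : ∀ x < m, o ≤ x → x % 2 = 1 → x ∈ Y := by
    intro x hx hox hx2
    rcases hox.lt_or_eq with hox | rfl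
    · refine h₂ o ho 0 hzero x hx ?_ ?_ <;> unfold interleaveKey <;> split_ifs <;> first | omega | contradiction
    · exact ho
  obtain ⟨l, hl, hlm, hl2⟩ : ∃ l ∈ Y, m ≤ l + 2 ∧ l % 2 = 1 := by
    rcases Nat.mod_two_eq_zero_or_one m with h | h
    · exact ⟨m - 1, hodd _ (by omega) (by omega) (by omega), by omega, by omega⟩
    · exact ⟨m - 2, hodd _ (by omega) (by omega) (by omega), by omega, by omega⟩
  have hlow : ∀ x ≤ l, x ∈ Y := by
    intro x hx
    rcases hx.lt_or_eq with hx | rfl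
    · rcases Nat.eq_zero_or_pos x with rfl | hpos
      · exact hzero
      · exact h₁ 0 hzero l hl x hpos hx
    · exact hl
  intro x hx
  by_cases hxl : x ≤ l
  · exact hlow x hxl
  -- Here `x = m - 1` is even and larger than `2`, so its key lies between those of `0` and `2`. The
  -- bound `m ≥ 4` gives `2 ≤ l`.
  · refine h₂ 0 hzero 2 (hlow 2 (by omega)) x hx ?_ ?_ <;> unfold interleaveKey <;>
      split_ifs <;> first | omega | contradiction

theorem implementable_fat_of_four_le [Nonempty V] {F : Set (Set V)} (hF : IsFat F) {m : ℕ}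
    (hm : 4 ≤ m) (c : Fin m ≃ V) (hk : 2 ≤ k) : Implementable k F := by
  refine implementable_of_keys hF c
    (fun i v => if i.1 = 0 then v.1 else interleaveKey m v.1) (fun i => ?_) fun Y hY h => ?_
  · by_cases hi : i.1 = 0 <;> simp only [hi, if_true, if_false]
    · exact Fin.val_injective
    · exact fun v w hvw => Fin.ext (interleaveKey_injOn m v.2 w.2 hvw)
  · have key := mem_of_common_interval hm (Y := Fin.val '' Y) (by rintro _ ⟨a, -, rfl⟩; exact a.2)
      (hY.image Fin.val_injective) ?_ ?_
    · intro x
      obtain ⟨y, hy, hyx⟩ := key x x.2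
      rwa [← Fin.ext hyx]
    · rintro _ ⟨a, ha, rfl⟩ _ ⟨b, hb, rfl⟩ x h₁ h₂
      exact ⟨⟨x, h₂.trans b.2⟩, h ⟨0, by omega⟩ a ha b hb _ (by simpa using h₁)
        (by simpa using h₂), rfl⟩
    · rintro _ ⟨a, ha, rfl⟩ _ ⟨b, hb, rfl⟩ x hx h₁ h₂
      exact ⟨⟨x, hx⟩, h ⟨1, by omega⟩ a ha b hb _ (by simpa using h₁) (by simpa using h₂), rfl⟩

/-- The voters use the cyclic rotations of one order. Each candidate is in the middle for one of
them, so a clone set containing the other two candidates must contain it. -/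
theorem implementable_fat_three [Nonempty V] {F : Set (Set V)} (hF : IsFat F) (c : Fin 3 ≃ V)
    (hk : 3 ≤ k) : Implementable k F := by
  refine implementable_of_keys hF c (fun i v => (v.1 + i.1) % 3) (fun i v w h => ?_)
    fun Y hY h x => ?_
  · have h : (v.1 + i.1) % 3 = (w.1 + i.1) % 3 := h
    omega
  · by_contra hx
    have hrest : ∀ y, y ≠ x → y ∈ Y := by
      intro y hy
      obtain ⟨a, ha, b, hb, hab⟩ := hY
      have hax : a ≠ x := by rintro rfl; exact hx ha
      have hbx : b ≠ x := by rintro rfl; exact hx hb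
      have : y = a ∨ y = b := by omega
      rcases this with rfl | rfl <;> assumption
    obtain ⟨i, hi⟩ : ∃ i : Fin k, (x.1 + i.1) % 3 = 1 := ⟨⟨(4 - x.1) % 3, by omega⟩, by
      change (x.1 + (4 - x.1) % 3) % 3 = 1
      omega⟩
    obtain ⟨a, ha⟩ : ∃ a : Fin 3, (a.1 + i.1) % 3 = 0 := ⟨⟨(x.1 + 2) % 3, by omega⟩, by
      change ((x.1 + 2) % 3 + i.1) % 3 = 0
      omega⟩
    obtain ⟨b, hb⟩ : ∃ b : Fin 3, (b.1 + i.1) % 3 = 2 := ⟨⟨(x.1 + 1) % 3, by omega⟩, by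
      change ((x.1 + 1) % 3 + i.1) % 3 = 2
      omega⟩
    refine hx (h i a (hrest a ?_) b (hrest b ?_) x ?_ ?_)
    · rintro rfl; omega
    · rintro rfl; omega
    · omega
    · omega

end Sausages

/-! ### Implementing a clone structure along its PQ-tree -/

namespace PQTree

variable {V W : Type u}

/-- The candidate `a` is the label of a leaf. -/
def HasLeaf (a : V) : PQTree V → Prop
  | .leaf b => a = b
  | .pnode _ ch => ∃ i, (ch i).HasLeaf a
  | .qnode _ ch => ∃ i, (ch i).HasLeaf a

theorem HasPNode.bind {d : ℕ} {T : PQTree V} (f : V → PQTree W) (h : T.HasPNode d) :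
    (T.bind f).HasPNode d := by
  induction T with
  | leaf a => exact h.elim
  | pnode k ch ih =>
    rcases h with h | ⟨i, h⟩
    exacts [Or.inl h, Or.inr ⟨i, ih i h⟩]
  | qnode k ch ih =>
    obtain ⟨i, h⟩ := h
    exact ⟨i, ih i h⟩

theorem HasLeaf.hasPNode_bind {d : ℕ} {T : PQTree V} {f : V → PQTree W} {a : V}
    (ha : T.HasLeaf a) (h : (f a).HasPNode d) : (T.bind f).HasPNode d := by
  induction T with
  | leaf b => exact (show a = b from ha) ▸ h
  | pnode k ch ih =>
    obtain ⟨i, ha⟩ := ha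
    exact Or.inr ⟨i, ih i ha⟩
  | qnode k ch ih =>
    obtain ⟨i, ha⟩ := ha
    exact ⟨i, ih i ha⟩

theorem HasLeaf.bind {T : PQTree V} {f : V → PQTree W} {a : V} {b : W}
    (ha : T.HasLeaf a) (hb : (f a).HasLeaf b) : (T.bind f).HasLeaf b := by
  induction T with
  | leaf c => exact (show a = c from ha) ▸ hb
  | pnode k ch ih =>
    obtain ⟨i, ha⟩ := ha
    exact ⟨i, ih i ha⟩
  | qnode k ch ih =>
    obtain ⟨i, ha⟩ := ha
    exact ⟨i, ih i ha⟩

end PQTree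

/-- A substituted subtree is visible only if its leaf occurs. This lets the absence of P-nodes with
three children pass from a tree to the trees of its subfamilies. -/
theorem IsPQTree.hasLeaf {V : Type u} {F : Set (Set V)} {T : PQTree V} (h : IsPQTree F T)
    (a : V) : T.HasLeaf a := by
  induction h with
  | single b hb _ => exact hb a
  | fat _ _ _ c => exact ⟨c.symm a, (c.apply_symm_apply a).symm⟩
  | string _ _ c _ => exact ⟨c.symm a, (c.apply_symm_apply a).symm⟩
  | @reducible V F hred S hS T hT ihS ihT =>
    rcases hs : toCollapsed F a with b | E
    · exact (ihT (Sum.inl b)).bind (toCollapsed_eq_inl_iff.1 hs)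
    · exact (ihT (Sum.inr E)).bind ((ihS E ⟨a, toCollapsed_eq_inr_iff.1 hs⟩).bind
        (f := fun x : E.1 => PQTree.leaf x.1) rfl)

/-- The disjunction `h₃` treats the claims for three and for two voters in one induction. It is used
only at a P-node with three children, the one case that calls for a third voter. -/
theorem IsPQTree.implementable {V : Type u} {F : Set (Set V)} {T : PQTree V} {k : ℕ}
    (hk : 2 ≤ k) (h : IsPQTree F T) [hne : Nonempty V] (hF : IsCloneStructure F)
    (h₃ : 3 ≤ k ∨ ¬ T.HasPNode 3) : Implementable k F := by
  induction h generalizing hne with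
  | single a ha hfat =>
    rename_i V F
    have : Subsingleton V := ⟨fun b c => (ha b).trans (ha c).symm⟩
    exact implementable_of_card_le_two hfat
      ((Finite.card_le_one_iff_subsingleton.2 this).trans one_le_two) k
  | @fat V F _ hfat m hm c =>
    have : Finite V := Finite.of_equiv _ c
    by_cases h₂ : m = 2
    · exact implementable_of_card_le_two hfat
        (by rw [← Nat.card_congr c, Nat.card_fin, h₂]) k
    by_cases h₄ : m = 3
    · subst h₄
      exact implementable_fat_three hfat c (h₃.resolve_right fun h => h (Or.inl rfl))
    · exact implementable_fat_of_four_le hfat (by omega) c hk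
  | string _ _ c hc => exact implementable_of_isStringAlong hc (one_le_two.trans hk)
  | @reducible V F hred S hS T hT ihS ihT =>
    refine implementable_of_fibers hk (toCollapsed_surjective F)
      hF.isSupport_toCollapsed_preimage ?_ ?_
    · have : Nonempty (Collapsed F) := ⟨toCollapsed F (Classical.arbitrary V)⟩
      rw [← hF.collapse_eq]
      exact ihT hF.collapse (h₃.imp_right fun h h' => h (h'.bind _))
    · rintro (b | E)
      · have hs := hF.restrict (hF.isSupport_toCollapsed_preimage (Sum.inl b)).1
        rw [toCollapsed_preimage_inl] at hs ⊢
        obtain ⟨n, hn, R, hR⟩ := hs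
        rw [hR]
        refine implementable_of_card_le_two (isFat_clones_iff.2 fun X _ hnt => ?_) (by simp) k
        exact (Set.not_nontrivial_iff.2 X.subsingleton_of_subsingleton hnt).elim
      · rw [toCollapsed_preimage_inr]
        have : Nonempty E.1 := E.2.1.nonempty.to_subtype
        exact ihS E (hF.restrict E.2.2.1.1) (h₃.imp_right fun h h' =>
          h ((hT.hasLeaf (Sum.inr E)).hasPNode_bind (h'.bind _)))

end CloneStructures

theorem theorem4p1 {V : Type u} [Finite V] [Nonempty V] (F : Set (Set V))
    (hF : CloneStructures.IsCloneStructure F) :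
    CloneStructures.Implementable 3 F ∧
    (∃ T : CloneStructures.PQTree V, CloneStructures.IsPQTree F T) ∧
    (∀ T : CloneStructures.PQTree V, CloneStructures.IsPQTree F T →
      ¬ T.HasPNode 3 → CloneStructures.Implementable 2 F) ∧
    (CloneStructures.IsString F → CloneStructures.Implementable 1 F) := by
  obtain ⟨T, hT⟩ := CloneStructures.exists_isPQTree hF
  refine ⟨hT.implementable (by norm_num) hF (Or.inl le_rfl), ⟨T, hT⟩,
    fun T hT h => hT.implementable le_rfl hF (Or.inr h), ?_⟩
  rintro ⟨m, c, hc⟩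
  exact CloneStructures.implementable_of_isStringAlong hc le_rfl
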